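/- A 2-Dyck path of length $3n$ is a sequence $a_1,\dots,a_{3n}\in\{+1,-2\}$ with $\sum_{i\le j}a_i\ge 0$ for all $1\le j\le 3n$ and $\sum_{i\le 3n}a_i=0$. Let $\Omega_n$ be the set of these paths and $\pi$ the uniform distribution on $\Omega_n$. The adjacent move chain on $\Omega_n$ has the following transitions: from $X$, choose $i\in\{1,\dots,3n-1\}$ uniformly at random and let $X'$ be $X$ with the steps at positions $i$ and $i+1$ swapped; if $X'\notin\Omega_n$, stay at $X$; otherwise move to $X'$ with probability $1/2$ and stay at $X$ with probability $1/2$. Let $P_n$ be its transition matrix (which is symmetric, hence reversible with respect to $\pi$). Write $$t_{\mathrm{mix}}(P_n)=\min\Bigl\{t\ge 0:\ \max_{x\in\Omega_n}\tfrac12\sum_{y\in\Omega_n}\bigl|P_n^t(x,y)-\pi(y)\bigr|\le \tfrac14\Bigr\},$$ $$\lambda(P_n)=\inf\Bigl\{\frac{\frac12\sum_{x,y}(f(x)-f(y))^2\pi(x)P_n(x,y)}{\mathrm{Var}_\pi(f)}:\ f:\Omega_n\to\mathbb R,\ \mathrm{Var}_\pi(f)\ne 0\Bigr\}.$$ Theorem.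 $t_{\mathrm{mix}}(P_n)=O(n^3\log n)$: there is an absolute constant $C$ such that for all $n\ge 2$ the mixing time $t_{\mathrm{mix}}(P_n)$ is finite and at most $C\,n^3\log n$. Corollary. $1/\lambda(P_n)=O(n^3\log n)$: there is an absolute constant $C'$ such that for all $n\ge 2$ one has $\lambda(P_n)>0$ and $1/\lambda(P_n)\le C'\,n^3\log n$. -/

import Mathlib

/-! ### Finite Markov chains, given by a transition matrix `P` and a distribution `π` -/

namespace FiniteChain

noncomputable section

variable {Ω : Type*} [Fintype Ω]

/-- Total variation distance `(1/2) ∑ₓ |μ(x) - ν(x)|`. -/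
def tvDist (μ ν : Ω → ℝ) : ℝ := (1 / 2) * ∑ x, |μ x - ν x|

/-- `d(t) = max_x d_TV(Pᵗ(x, ·), π)`, the maximum being over the (finite) state space. -/
def worstDist [DecidableEq Ω] (P : Matrix Ω Ω ℝ) (π : Ω → ℝ) (t : ℕ) : ℝ :=
  ⨆ x, tvDist ((P ^ t) x) π

/-- `t_mix(P) = min {t : d(t) ≤ 1/4}`. -/
def mixingTime [DecidableEq Ω] (P : Matrix Ω Ω ℝ) (π : Ω → ℝ) : ℕ :=
  sInf {t | worstDist P π t ≤ 1 / 4}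

/-- The Dirichlet form `𝓔_P(f,g)`. -/
def dirichletForm (P : Matrix Ω Ω ℝ) (π : Ω → ℝ) (f g : Ω → ℝ) : ℝ :=
  (1 / 2) * ∑ x, ∑ y, (f x - f y) * (g x - g y) * π x * P x y

/-- The variance `𝔼_π[f²] - (𝔼_π[f])²`. -/
def variance (π : Ω → ℝ) (f : Ω → ℝ) : ℝ :=
  ∑ x, π x * f x ^ 2 - (∑ x, π x * f x) ^ 2

/-- The spectral gap `inf {𝓔_P(f,f) / Var_π(f) : Var_π(f) ≠ 0}`. -/
def spectralGap (P : Matrix Ω Ω ℝ) (π : Ω → ℝ) : ℝ :=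
  sInf {r | ∃ f : Ω → ℝ, variance π f ≠ 0 ∧ r = dirichletForm P π f f / variance π f}

/-- The uniform distribution. -/
def uniform (Ω : Type*) [Fintype Ω] : Ω → ℝ := fun _ => 1 / (Fintype.card Ω : ℝ)

end

end FiniteChain

/-! ### 2-Dyck paths and the adjacent move chain -/

namespace TwoDyck

/-- The height after `j` steps; `true` is an up-step (`+1`), `false` a down-step (`-2`). -/
def height {m : ℕ} (a : Fin m → Bool) (j : ℕ) : ℤ :=
  ∑ i : Fin m, if (i : ℕ) < j then (if a i then 1 else -2) else 0

/-- A sequence of `3n` steps is a 2-Dyck path if it never goes below height `0` and ends at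
height `0`. -/
def IsPath (n : ℕ) (a : Fin (3 * n) → Bool) : Prop :=
  (∀ j ∈ Finset.Icc 1 (3 * n), 0 ≤ height a j) ∧ height a (3 * n) = 0

instance (n : ℕ) : DecidablePred (IsPath n) := fun a => by
  unfold IsPath; infer_instance

/-- The 2-Dyck paths of length `3n`. -/
abbrev Path (n : ℕ) : Type := {a : Fin (3 * n) → Bool // IsPath n a}

/-- Swap the steps at the (zero-based) positions `i` and `i + 1`. -/
def adjSwap {n : ℕ} (a : Fin (3 * n) → Bool) (i : Fin (3 * n - 1)) : Fin (3 * n) → Bool :=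
  a ∘ Equiv.swap ⟨i, by omega⟩ ⟨i + 1, by omega⟩

noncomputable section

/-- The probability of going from `X` to `Y` once the position `i` has been chosen: if the swap
at `i` is a valid path, move there with probability `1/2` and stay with probability `1/2`;
otherwise stay. -/
def moveProb {n : ℕ} (i : Fin (3 * n - 1)) (X Y : Path n) : ℝ :=
  if IsPath n (adjSwap X.1 i) then
    (if Y.1 = adjSwap X.1 i then 1 / 2 else 0) + (if Y = X then 1 / 2 else 0)
  else
    if Y = X then 1 else 0

/-- The transition matrix of the adjacent move chain: the position is chosen uniformly among the
`3n - 1` possible ones. -/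
def amChain (n : ℕ) : Matrix (Path n) (Path n) ℝ :=
  fun X Y => ∑ i : Fin (3 * n - 1), 1 / (3 * (n : ℝ) - 1) * moveProb i X Y

end

/-- The rows of the transition matrix sum to `1`. -/
theorem amChain_row_sum {n : ℕ} (hn : 1 ≤ n) (X : Path n) : ∑ Y, amChain n X Y = 1 := by
  have h : ∀ i : Fin (3 * n - 1), ∑ Y, moveProb i X Y = 1 := by
    intro i
    unfold moveProb
    by_cases hp : IsPath n (adjSwap X.1 i)
    · have : ∀ Y : Path n, (Y.1 = adjSwap X.1 i) = (Y = ⟨adjSwap X.1 i, hp⟩) := by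
        intro Y; rw [Subtype.ext_iff]
      simp only [hp, if_true, this, Finset.sum_add_distrib, Finset.sum_ite_eq',
        Finset.mem_univ]
      norm_num
    · simp [hp]
  unfold amChain
  rw [Finset.sum_comm]
  simp only [← Finset.mul_sum, h]
  have h3 : ((3 * n - 1 : ℕ) : ℝ) = 3 * (n : ℝ) - 1 := by
    rw [Nat.cast_sub (by omega)]; push_cast; ring
  have hpos : (3 * (n : ℝ) - 1) ≠ 0 := by
    have : (1 : ℝ) ≤ n := by exact_mod_cast hn
    linarith
  simp only [Finset.sum_const, Finset.card_univ, Fintype.card_fin, nsmul_eq_mul, h3]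
  field_simp

/-- The transition matrix is symmetric, so the chain is reversible with respect to the uniform
distribution. -/
theorem amChain_symm {n : ℕ} (X Y : Path n) : amChain n X Y = amChain n Y X := by
  have hinv : ∀ (a : Fin (3 * n) → Bool) (i : Fin (3 * n - 1)),
      adjSwap (adjSwap a i) i = a := by
    intro a i; funext j; simp [adjSwap]
  unfold amChain
  refine Finset.sum_congr rfl fun i _ => ?_
  congr 1
  by_cases hXY : X = Y
  · rw [hXY]
  have hYX : Y ≠ X := fun h => hXY h.symm
  unfold moveProb
  by_cases h : Y.1 = adjSwap X.1 i
  · have h' : X.1 = adjSwap Y.1 i := by rw [h, hinv]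
    have hp : IsPath n (adjSwap X.1 i) := h ▸ Y.2
    have hp' : IsPath n (adjSwap Y.1 i) := h' ▸ X.2
    simp only [if_pos hp, if_pos hp', if_pos h, if_pos h', if_neg hXY, if_neg hYX]
  · have h' : ¬ X.1 = adjSwap Y.1 i := fun h' => h (by rw [h', hinv])
    simp only [if_neg h, if_neg h', if_neg hXY, if_neg hYX]
    simp

/-- The off-diagonal entries: `1 / (6n - 2)` if `Y` arises from `X` by swapping two adjacent
steps, and `0` otherwise. -/
theorem amChain_of_ne {n : ℕ} {X Y : Path n} (hYX : Y ≠ X) :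
    amChain n X Y =
      if ∃ i : Fin (3 * n - 1), Y.1 = adjSwap X.1 i then 1 / (6 * (n : ℝ) - 2) else 0 := by
  have hterm : ∀ i : Fin (3 * n - 1),
      moveProb i X Y = if Y.1 = adjSwap X.1 i then 1 / 2 else 0 := by
    intro i
    unfold moveProb
    by_cases h : Y.1 = adjSwap X.1 i
    · have hp : IsPath n (adjSwap X.1 i) := h ▸ Y.2
      simp only [if_pos hp, if_pos h, if_neg hYX, add_zero]
    · simp only [if_neg h, if_neg hYX]
      simp
  unfold amChain
  simp only [hterm]
  by_cases hex : ∃ i : Fin (3 * n - 1), Y.1 = adjSwap X.1 i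
  · obtain ⟨i, hi⟩ := hex
    have key : ∀ (j : Fin (3 * n - 1)) (m : Fin (3 * n)), Y.1 = adjSwap X.1 j →
        Y.1 m ≠ X.1 m → (m : ℕ) = j ∨ (m : ℕ) = j + 1 := by
      intro j m hj hm
      by_contra hcon
      push Not at hcon
      apply hm
      rw [hj, adjSwap, Function.comp_apply, Equiv.swap_apply_of_ne_of_ne]
      · exact fun h => hcon.1 (by rw [h])
      · exact fun h => hcon.2 (by rw [h])
    have both : ∀ j : Fin (3 * n - 1), Y.1 = adjSwap X.1 j →
        Y.1 ⟨j, by omega⟩ ≠ X.1 ⟨j, by omega⟩ ∧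
          Y.1 ⟨j + 1, by omega⟩ ≠ X.1 ⟨j + 1, by omega⟩ := by
      intro j hj
      have h1 : Y.1 ⟨j, by omega⟩ = X.1 ⟨j + 1, by omega⟩ := by simp [hj, adjSwap]
      have h2 : Y.1 ⟨j + 1, by omega⟩ = X.1 ⟨j, by omega⟩ := by simp [hj, adjSwap]
      have hne : X.1 ⟨j, by omega⟩ ≠ X.1 ⟨j + 1, by omega⟩ := by
        intro he
        apply hYX
        apply Subtype.ext
        funext m
        by_contra hm
        rcases key j m hj hm with h | h
        · have : m = ⟨j, by omega⟩ := Fin.ext h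
          rw [this] at hm
          exact hm (h1.trans he.symm)
        · have : m = ⟨j + 1, by omega⟩ := Fin.ext h
          rw [this] at hm
          exact hm (h2.trans he)
      exact ⟨by rw [h1]; exact hne.symm, by rw [h2]; exact hne⟩
    have huniq : ∀ j : Fin (3 * n - 1), (Y.1 = adjSwap X.1 j) = (j = i) := by
      intro j
      refine propext ⟨fun hj => ?_, fun h => h ▸ hi⟩
      have a1 := key i _ hi (both j hj).1
      have a2 := key i _ hi (both j hj).2
      apply Fin.ext
      simp only at a1 a2
      omega
    rw [if_pos ⟨i, hi⟩]
    simp only [huniq, mul_ite, mul_zero, Finset.sum_ite_eq', Finset.mem_univ, if_true]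
    rw [div_mul_div_comm]
    congr 1 <;> ring
  · rw [if_neg hex]
    push Not at hex
    simp [hex]

end TwoDyck

/-! The proof is a monotone coupling combined with a weighted area that contracts on average. Once a
position `i` is chosen, the two equally likely outcomes are regrouped as "raise if possible" and
"lower if possible". Both updates preserve the pointwise order of heights: steps are congruent to 1
mod 3, so two paths that differ at a position differ there by at least 3, the size of one move.

For ordered paths, the area difference with weights `j (3n - j)` has negative drift. Away from the
floor, the sum of the old and the swapped height equals the sum of the neighbouring heights, so the
drift is a discrete Laplacian; summation by parts against a parabola makes it minus twice the
unweighted area difference (`sum_weight_mul_laplacian`). The floor only helps, since the upper path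
is refused a swap only where the lower one is too (`Below.local_bounds`).

Hence a function that is Lipschitz for this area along ordered pairs has its constant reduced by the
factor `1 - 1/(3n)^3` at each step (`abs_amChain_mulVec_sub_le`). Every path lies below `top`, so
the oscillation of `P ^ t f` is at most a polynomial in `n` times this factor to the power `t`.
Testing against signs turns this into total variation, where the polynomial costs the logarithm. For
the gap the prefactor disappears: by symmetry of `P`, the squared norms of `P ^ t g` are log-convex
in `t`, so the asymptotic rate already bounds the first step. -/

namespace TwoDyck

/-! ### Heights and adjacent swaps. -/

/-- The height increment of a step. -/
def stepVal (b : Bool) : ℤ := if b then 1 else -2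

theorem stepVal_eq (b : Bool) : stepVal b = 1 ∨ stepVal b = -2 := by
  cases b <;> simp [stepVal]

theorem stepVal_injective : Function.Injective stepVal := by
  intro a b; cases a <;> cases b <;> simp [stepVal]

theorem height_zero {m : ℕ} (a : Fin m → Bool) : height a 0 = 0 := by
  simp [height]

theorem height_succ {m : ℕ} (a : Fin m → Bool) (j : ℕ) (hj : j < m) :
    height a (j + 1) = height a j + stepVal (a ⟨j, hj⟩) := by
  have h : ∀ i : Fin m, (if (i : ℕ) < j + 1 then (if a i then (1 : ℤ) else -2) else 0) =
      (if (i : ℕ) < j then (if a i then 1 else -2) else 0) +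
        if i = ⟨j, hj⟩ then stepVal (a i) else 0 := by
    intro i
    rcases lt_trichotomy (i : ℕ) j with h | h | h
    · have h2 : i ≠ ⟨j, hj⟩ := fun h' => by simp [h'] at h
      simp [h, h2, Nat.lt_succ_of_lt h]
    · have h2 : i = ⟨j, hj⟩ := Fin.ext h
      simp [h2, stepVal]
    · have h2 : i ≠ ⟨j, hj⟩ := fun h' => by simp [h'] at h
      have h3 : ¬ (i : ℕ) < j + 1 := by omega
      have h4 : ¬ (i : ℕ) < j := by omega
      simp [h2, h3, h4]
  unfold height
  rw [Finset.sum_congr rfl fun i _ => h i, Finset.sum_add_distrib]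
  simp

theorem height_adjSwap {n : ℕ} (a : Fin (3 * n) → Bool) (i : Fin (3 * n - 1)) (j : ℕ)
    (hj : j ≤ 3 * n) :
    height (adjSwap a i) j = height a j +
      if j = i + 1 then stepVal (a ⟨i + 1, by omega⟩) - stepVal (a ⟨i, by omega⟩) else 0 := by
  induction j with
  | zero => simp [height_zero]
  | succ j ih =>
    rw [height_succ _ j hj, height_succ _ j hj, ih (by omega)]
    by_cases h1 : j = i
    · subst h1
      simp [adjSwap]
    by_cases h2 : j = i + 1
    · subst h2
      simp [adjSwap, add_assoc]
    · have h3 : adjSwap a i ⟨j, hj⟩ = a ⟨j, hj⟩ := by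
        rw [adjSwap, Function.comp_apply, Equiv.swap_apply_of_ne_of_ne]
        · exact fun h => h1 (congrArg Fin.val h)
        · exact fun h => h2 (congrArg Fin.val h)
      rw [h3, if_neg h2, if_neg (by omega)]
      ring

theorem height_adjSwap_of_ne {n : ℕ} (a : Fin (3 * n) → Bool) (i : Fin (3 * n - 1)) (j : ℕ)
    (hj : j ≤ 3 * n) (hne : j ≠ i + 1) : height (adjSwap a i) j = height a j := by
  rw [height_adjSwap a i j hj, if_neg hne, add_zero]

theorem height_adjSwap_self {n : ℕ} (a : Fin (3 * n) → Bool) (i : Fin (3 * n - 1)) :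
    height (adjSwap a i) (i + 1) = height a i + height a (i + 2) - height a (i + 1) := by
  rw [height_adjSwap a i _ (by omega), if_pos rfl, height_succ a (i + 1) (by omega),
    height_succ a i (by omega)]
  ring

namespace Path

variable {n : ℕ}

/-- The height of a path after `j` steps. -/
def ht (x : Path n) (j : ℕ) : ℤ := height x.1 j

theorem ht_zero (x : Path n) : x.ht 0 = 0 := height_zero _

theorem ht_end (x : Path n) : x.ht (3 * n) = 0 := x.2.2

theorem ht_nonneg (x : Path n) {j : ℕ} (hj : j ≤ 3 * n) : 0 ≤ x.ht j := by
  rcases Nat.eq_zero_or_pos j with rfl | h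
  · rw [ht_zero]
  · exact x.2.1 j (Finset.mem_Icc.2 ⟨h, hj⟩)

theorem ht_succ (x : Path n) {j : ℕ} (hj : j < 3 * n) :
    x.ht (j + 1) = x.ht j + 1 ∨ x.ht (j + 1) = x.ht j - 2 := by
  have h := height_succ x.1 j hj
  unfold ht
  rcases stepVal_eq (x.1 ⟨j, hj⟩) with h1 | h1 <;> rw [h1] at h <;> omega

/-- Both 1 and -2 are 1 mod 3. Consequently two different heights at the same position are at least
3 apart, which keeps ordered paths from crossing in a single move. -/
theorem ht_emod (x : Path n) {j : ℕ} (hj : j ≤ 3 * n) : x.ht j % 3 = (j : ℤ) % 3 := by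
  induction j with
  | zero => simp [ht_zero]
  | succ j ih =>
    have h1 := ih (by omega)
    rcases x.ht_succ (j := j) (by omega) with h | h <;> push_cast <;> omega

theorem ht_le (x : Path n) {j : ℕ} (hj : j ≤ 3 * n) : x.ht j ≤ j := by
  induction j with
  | zero => simp [ht_zero]
  | succ j ih =>
    have h1 := ih (by omega)
    rcases x.ht_succ (j := j) (by omega) with h | h <;> push_cast <;> omega

theorem ht_le_two_mul (x : Path n) {k : ℕ} (hk : k ≤ 3 * n) : x.ht (3 * n - k) ≤ 2 * k := by
  induction k with
  | zero => simp [ht_end]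
  | succ k ih =>
    have h1 := ih (by omega)
    have h2 : 3 * n - k = (3 * n - (k + 1)) + 1 := by omega
    rw [h2] at h1
    rcases x.ht_succ (j := 3 * n - (k + 1)) (by omega) with h | h <;> push_cast <;> omega

theorem ext_ht {x y : Path n} (h : ∀ j ≤ 3 * n, x.ht j = y.ht j) : x = y := by
  apply Subtype.ext
  funext j
  apply stepVal_injective
  have h1 := height_succ x.1 j j.2
  have h2 := height_succ y.1 j j.2
  have h3 := h j j.2.le
  have h4 := h (j + 1) j.2
  unfold ht at h3 h4
  simp only [Fin.eta] at h1 h2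
  omega

/-! ### The pointwise order and the monotone updates. -/

/-- The pointwise order on paths. -/
def Below (x y : Path n) : Prop := ∀ j ≤ 3 * n, x.ht j ≤ y.ht j

theorem isPath_adjSwap (x : Path n) (i : Fin (3 * n - 1))
    (h : 0 ≤ x.ht i + x.ht (i + 2) - x.ht (i + 1)) : IsPath n (adjSwap x.1 i) := by
  refine ⟨fun j hj => ?_, ?_⟩
  · have hj' := (Finset.mem_Icc.1 hj).2
    by_cases hji : j = i + 1
    · rw [hji, height_adjSwap_self]; exact h
    · rw [height_adjSwap_of_ne _ _ _ hj' hji]; exact x.ht_nonneg hj'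
  · rw [height_adjSwap_of_ne _ _ _ le_rfl (by omega)]; exact x.ht_end

/-- The swap at `i`, or the path itself if the swap is not valid. -/
def swapAt (i : Fin (3 * n - 1)) (x : Path n) : Path n :=
  if h : IsPath n (adjSwap x.1 i) then ⟨adjSwap x.1 i, h⟩ else x

theorem ht_swapAt_of_ne (i : Fin (3 * n - 1)) (x : Path n) {j : ℕ} (hj : j ≤ 3 * n)
    (hne : j ≠ i + 1) : (swapAt i x).ht j = x.ht j := by
  unfold swapAt
  split_ifs with h
  · exact height_adjSwap_of_ne _ _ _ hj hne
  · rfl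

/-- The swap is refused only at a peak `1, 2, 0`. -/
theorem ht_swapAt_self (i : Fin (3 * n - 1)) (x : Path n) :
    (swapAt i x).ht (i + 1) = x.ht i + x.ht (i + 2) - x.ht (i + 1) ∨
      ((swapAt i x).ht (i + 1) = 2 ∧ x.ht i = 1 ∧ x.ht (i + 1) = 2 ∧ x.ht (i + 2) = 0) := by
  by_cases h : IsPath n (adjSwap x.1 i)
  · left
    rw [swapAt, dif_pos h]
    exact height_adjSwap_self _ _
  · right
    rw [swapAt, dif_neg h]
    have h0 : ¬ 0 ≤ x.ht i + x.ht (i + 2) - x.ht (i + 1) := fun h' => h (x.isPath_adjSwap i h')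
    have h1 := x.ht_succ (j := i) (by omega)
    have h2 : x.ht (i + 2) = x.ht (i + 1) + 1 ∨ x.ht (i + 2) = x.ht (i + 1) - 2 :=
      x.ht_succ (j := i + 1) (by omega)
    have h3 := x.ht_nonneg (j := i) (by omega)
    have h4 := x.ht_nonneg (j := i + 1) (by omega)
    have h5 := x.ht_nonneg (j := i + 2) (by omega)
    omega

/-- The update at `i` that raises the path if possible. -/
def raise (i : Fin (3 * n - 1)) (x : Path n) : Path n :=
  if x.ht (i + 1) ≤ (swapAt i x).ht (i + 1) then swapAt i x else x

/-- The update at `i` that lowers the path if possible. -/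
def lower (i : Fin (3 * n - 1)) (x : Path n) : Path n :=
  if x.ht (i + 1) ≤ (swapAt i x).ht (i + 1) then x else swapAt i x

theorem raise_add_lower (i : Fin (3 * n - 1)) (x : Path n) (f : Path n → ℝ) :
    f (raise i x) + f (lower i x) = f x + f (swapAt i x) := by
  unfold raise lower
  split_ifs
  · ring
  · ring

theorem ht_raise_of_ne (i : Fin (3 * n - 1)) (x : Path n) {j : ℕ} (hj : j ≤ 3 * n)
    (hne : j ≠ i + 1) : (raise i x).ht j = x.ht j := by
  unfold raise
  split_ifs
  · exact ht_swapAt_of_ne i x hj hne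
  · rfl

theorem ht_lower_of_ne (i : Fin (3 * n - 1)) (x : Path n) {j : ℕ} (hj : j ≤ 3 * n)
    (hne : j ≠ i + 1) : (lower i x).ht j = x.ht j := by
  unfold lower
  split_ifs
  · rfl
  · exact ht_swapAt_of_ne i x hj hne

theorem ht_raise_self (i : Fin (3 * n - 1)) (x : Path n) :
    (raise i x).ht (i + 1) = max (x.ht (i + 1)) ((swapAt i x).ht (i + 1)) := by
  unfold raise
  split_ifs <;> omega

theorem ht_lower_self (i : Fin (3 * n - 1)) (x : Path n) :
    (lower i x).ht (i + 1) = min (x.ht (i + 1)) ((swapAt i x).ht (i + 1)) := by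
  unfold lower
  split_ifs <;> omega

/-- If the middle heights differ, the gap of at least 3 absorbs a move; if they agree, a valley of
`x` forces one of `y`, and a peak of `y` forces one of `x`. A refusal at `y` means heights 1, 2, 0,
and order, residues and nonnegativity then force the same heights on `x`. A refusal at `x` alone
only decreases the left side of the third inequality. -/
theorem Below.local_bounds {x y : Path n} (h : Below x y) (i : Fin (3 * n - 1)) :
    (raise i x).ht (i + 1) ≤ (raise i y).ht (i + 1) ∧
      (lower i x).ht (i + 1) ≤ (lower i y).ht (i + 1) ∧
      (y.ht (i + 1) + (swapAt i y).ht (i + 1)) - (x.ht (i + 1) + (swapAt i x).ht (i + 1)) ≤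
        (y.ht i + y.ht (i + 2)) - (x.ht i + x.ht (i + 2)) := by
  rw [ht_raise_self, ht_raise_self, ht_lower_self, ht_lower_self]
  have a0 := h i (by omega)
  have a1 := h (i + 1) (by omega)
  have a2 := h (i + 2) (by omega)
  have x1 := x.ht_succ (j := i) (by omega)
  have x2 : x.ht (i + 2) = x.ht (i + 1) + 1 ∨ x.ht (i + 2) = x.ht (i + 1) - 2 :=
    x.ht_succ (j := i + 1) (by omega)
  have y1 := y.ht_succ (j := i) (by omega)
  have y2 : y.ht (i + 2) = y.ht (i + 1) + 1 ∨ y.ht (i + 2) = y.ht (i + 1) - 2 :=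
    y.ht_succ (j := i + 1) (by omega)
  have xm := x.ht_emod (j := i) (by omega)
  have ym := y.ht_emod (j := i) (by omega)
  have xn := x.ht_nonneg (j := i) (by omega)
  have xn1 := x.ht_nonneg (j := i + 1) (by omega)
  have xn2 := x.ht_nonneg (j := i + 2) (by omega)
  have sx := (swapAt i x).ht_nonneg (j := i + 1) (by omega)
  have sy := (swapAt i y).ht_nonneg (j := i + 1) (by omega)
  have hx := ht_swapAt_self i x
  have hy := ht_swapAt_self i y
  rcases x1 with x1 | x1 <;> rcases x2 with x2 | x2 <;> rcases y1 with y1 | y1 <;>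
    rcases y2 with y2 | y2 <;> rcases hx with hx | hx <;> rcases hy with hy | hy <;>
    refine ⟨?_, ?_, ?_⟩ <;> omega

theorem Below.raise {x y : Path n} (h : Below x y) (i : Fin (3 * n - 1)) :
    Below (raise i x) (raise i y) := by
  intro j hj
  by_cases hji : j = i + 1
  · rw [hji]; exact (h.local_bounds i).1
  · rw [ht_raise_of_ne _ _ hj hji, ht_raise_of_ne _ _ hj hji]; exact h j hj

theorem Below.lower {x y : Path n} (h : Below x y) (i : Fin (3 * n - 1)) :
    Below (lower i x) (lower i y) := by
  intro j hj
  by_cases hji : j = i + 1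
  · rw [hji]; exact (h.local_bounds i).2.1
  · rw [ht_lower_of_ne _ _ hj hji, ht_lower_of_ne _ _ hj hji]; exact h j hj

/-! ### The maximal path. -/

theorem height_eq_of_ups {a : Fin (3 * n) → Bool} (ha : ∀ i, a i = decide ((i : ℕ) < 2 * n)) {j : ℕ}
    (hj : j ≤ 3 * n) : height a j = min (j : ℤ) (6 * n - 2 * j) := by
  induction j with
  | zero => simp [height_zero]
  | succ j ih =>
    rw [height_succ a j hj, ih (by omega), ha]
    by_cases h : j < 2 * n <;> simp [stepVal, h] <;> omega

/-- The path that consists of `2n` up-steps followed by `n` down-steps. -/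
def top (n : ℕ) : Path n :=
  ⟨fun i => decide ((i : ℕ) < 2 * n), by
    refine ⟨fun j hj => ?_, ?_⟩
    · have hj' := (Finset.mem_Icc.1 hj).2
      rw [height_eq_of_ups (fun _ => rfl) hj']
      omega
    · rw [height_eq_of_ups (fun _ => rfl) le_rfl]
      push_cast
      omega⟩

theorem ht_top {j : ℕ} (hj : j ≤ 3 * n) : (top n).ht j = min (j : ℤ) (6 * n - 2 * j) :=
  height_eq_of_ups (fun _ => rfl) hj

theorem below_top (x : Path n) : Below x (top n) := by
  intro j hj
  rw [ht_top hj]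
  have h1 := x.ht_le hj
  have h2 := x.ht_le_two_mul (k := 3 * n - j) (by omega)
  have h3 : 3 * n - (3 * n - j) = j := by omega
  rw [h3] at h2
  push_cast [hj] at h2
  omega

/-- Nontriviality of the state space gives the gap an infimum over a nonempty set. The witness flips
the summit of `top`, which is high enough above the floor when `n ≥ 2`. -/
theorem exists_ne_top (hn : 2 ≤ n) : ∃ x : Path n, x ≠ top n := by
  have hi : 2 * n - 1 < 3 * n - 1 := by omega
  have e0 : (top n).ht (2 * n - 1) = 2 * n - 1 := by
    rw [ht_top (by omega)]; omega
  have e1 : (top n).ht (2 * n - 1 + 1) = 2 * n := by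
    rw [ht_top (by omega)]; omega
  have e2 : (top n).ht (2 * n - 1 + 2) = 2 * n - 2 := by
    rw [ht_top (by omega)]; omega
  refine ⟨swapAt ⟨2 * n - 1, hi⟩ (top n), fun h => ?_⟩
  have h1 := ht_swapAt_self ⟨2 * n - 1, hi⟩ (top n)
  rw [h] at h1
  simp only [e0, e1, e2] at h1
  omega

/-! ### The weighted area and its drift. -/

/-- The weighted area under a path, with weights `j (3n - j)`. -/
noncomputable def area (x : Path n) : ℝ :=
  ∑ j ∈ Finset.range (3 * n + 1), (j : ℝ) * (3 * n - j) * x.ht j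

theorem area_sub_area (x y : Path n) :
    y.area - x.area =
      ∑ j ∈ Finset.range (3 * n + 1), (j : ℝ) * (3 * n - j) * ((y.ht j : ℝ) - x.ht j) := by
  unfold area
  rw [← Finset.sum_sub_distrib]
  exact Finset.sum_congr rfl fun j _ => by ring

theorem weight_nonneg {j : ℕ} (hj : j ≤ 3 * n) : 0 ≤ (j : ℝ) * (3 * n - j) := by
  have : (j : ℝ) ≤ 3 * n := by exact_mod_cast hj
  exact mul_nonneg (Nat.cast_nonneg _) (by linarith)

theorem weight_le {j : ℕ} (hj : j ≤ 3 * n) : (j : ℝ) * (3 * n - j) ≤ (3 * n : ℝ) ^ 2 := by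
  have : (j : ℝ) ≤ 3 * n := by exact_mod_cast hj
  have h0 : (0 : ℝ) ≤ j := Nat.cast_nonneg _
  nlinarith

theorem area_nonneg (x : Path n) : 0 ≤ x.area := by
  refine Finset.sum_nonneg fun j hj => ?_
  have hj' : j ≤ 3 * n := by have := Finset.mem_range.1 hj; omega
  exact mul_nonneg (weight_nonneg hj') (by exact_mod_cast x.ht_nonneg hj')

theorem area_le (hn : 1 ≤ n) (x : Path n) : x.area ≤ 2 * (3 * n : ℝ) ^ 4 := by
  have h : ∀ j ∈ Finset.range (3 * n + 1),
      (j : ℝ) * (3 * n - j) * x.ht j ≤ (3 * n : ℝ) ^ 2 * (3 * n) := by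
    intro j hj
    have hj' : j ≤ 3 * n := by have := Finset.mem_range.1 hj; omega
    have h1 : (x.ht j : ℝ) ≤ j := by exact_mod_cast x.ht_le hj'
    have h2 : (j : ℝ) ≤ 3 * n := by exact_mod_cast hj'
    have h3 : (0 : ℝ) ≤ x.ht j := by exact_mod_cast x.ht_nonneg hj'
    exact mul_le_mul (weight_le hj') (h1.trans h2) h3 (by positivity)
  have h1 : (1 : ℝ) ≤ n := by exact_mod_cast hn
  calc x.area ≤ ∑ j ∈ Finset.range (3 * n + 1), (3 * n : ℝ) ^ 2 * (3 * n) :=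
        Finset.sum_le_sum h
    _ = (3 * n + 1) * ((3 * n : ℝ) ^ 2 * (3 * n)) := by simp
    _ ≤ (2 * (3 * n)) * ((3 * n : ℝ) ^ 2 * (3 * n)) := by gcongr; linarith
    _ = 2 * (3 * n : ℝ) ^ 4 := by ring

theorem Below.area_le_area {x y : Path n} (h : Below x y) : x.area ≤ y.area := by
  rw [← sub_nonneg, area_sub_area]
  refine Finset.sum_nonneg fun j hj => ?_
  have hj' : j ≤ 3 * n := by have := Finset.mem_range.1 hj; omega
  have := h j hj'
  exact mul_nonneg (weight_nonneg hj') (sub_nonneg.2 (by exact_mod_cast this))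

/-- The weight vanishes only at the two ends, where all paths agree; elsewhere it is at least 1.
This makes any function of bounded oscillation Lipschitz for the area. -/
theorem Below.one_le_area_sub {x y : Path n} (h : Below x y) (hne : x ≠ y) :
    1 ≤ y.area - x.area := by
  obtain ⟨j, hj, hlt⟩ : ∃ j ≤ 3 * n, x.ht j < y.ht j := by
    by_contra hcon
    push Not at hcon
    exact hne (ext_ht fun j hj => le_antisymm (h j hj) (hcon j hj))
  have hj0 : j ≠ 0 := by rintro rfl; simp [ht_zero] at hlt
  have hjN : j ≠ 3 * n := by rintro rfl; simp [ht_end] at hlt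
  have h1 : (1 : ℝ) ≤ j := by exact_mod_cast Nat.one_le_iff_ne_zero.2 hj0
  have h2 : (j : ℝ) + 1 ≤ 3 * n := by
    have : j + 1 ≤ 3 * n := by omega
    exact_mod_cast this
  have h3 : (x.ht j : ℝ) + 1 ≤ y.ht j := by exact_mod_cast hlt
  rw [area_sub_area]
  have hterm : 1 ≤ (j : ℝ) * (3 * n - j) * ((y.ht j : ℝ) - x.ht j) := by
    have : (1 : ℝ) ≤ j * (3 * n - j) := one_le_mul_of_one_le_of_one_le h1 (by linarith)
    exact one_le_mul_of_one_le_of_one_le this (by linarith)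
  refine hterm.trans (Finset.single_le_sum
    (f := fun j : ℕ => (j : ℝ) * (3 * n - j) * ((y.ht j : ℝ) - x.ht j))
    (fun k hk => ?_) (Finset.mem_range.2 (by omega)))
  have hk' : k ≤ 3 * n := by have := Finset.mem_range.1 hk; omega
  have := h k hk'
  exact mul_nonneg (weight_nonneg hk') (sub_nonneg.2 (by exact_mod_cast this))

theorem area_swapAt (i : Fin (3 * n - 1)) (x : Path n) :
    (swapAt i x).area = x.area +
      ((i + 1 : ℕ) : ℝ) * (3 * n - (i + 1 : ℕ)) * ((swapAt i x).ht (i + 1) - x.ht (i + 1)) := by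
  have h := area_sub_area x (swapAt i x)
  rw [Finset.sum_eq_single_of_mem (i + 1 : ℕ) (Finset.mem_range.2 (by omega))] at h
  · linarith
  · intro j hj hne
    have hj' : j ≤ 3 * n := by have := Finset.mem_range.1 hj; omega
    rw [ht_swapAt_of_ne i x hj' hne]
    ring

end Path

/-- Summation by parts against the parabola `j (N - j)`. -/
theorem sum_weight_mul_laplacian (N : ℝ) (D : ℕ → ℝ) (M : ℕ) :
    ∑ i ∈ Finset.range M, (((i : ℝ) + 1) * (N - (i + 1)) * (D i + D (i + 2) - 2 * D (i + 1))) =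
      -2 * ∑ i ∈ Finset.range M, D (i + 1) + (N - 1) * D 0
        + M * (N - M) * D (M + 1) - (M + 1) * (N - (M + 1)) * D M := by
  induction M with
  | zero => simp
  | succ M ih =>
    rw [Finset.sum_range_succ, Finset.sum_range_succ, ih]
    push_cast
    ring

namespace Path

variable {n : ℕ}

theorem Below.sum_area_swapAt_le (hn : 1 ≤ n) {x y : Path n} (h : Below x y) :
    ∑ i : Fin (3 * n - 1), ((swapAt i y).area - (swapAt i x).area - (y.area - x.area)) ≤
      -(2 / (3 * n : ℝ) ^ 2) * (y.area - x.area) := by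
  set D : ℕ → ℝ := fun j => (y.ht j : ℝ) - x.ht j with hD
  have hD0 : D 0 = 0 := by simp [hD, ht_zero]
  have hDN : D (3 * n) = 0 := by simp [hD, ht_end]
  have hpos : (0 : ℝ) < (3 * n : ℝ) ^ 2 := by
    have : (1 : ℝ) ≤ n := by exact_mod_cast hn
    positivity
  have hterm : ∀ i : Fin (3 * n - 1),
      (swapAt i y).area - (swapAt i x).area - (y.area - x.area) ≤
        (((i : ℕ) : ℝ) + 1) * (3 * n - (((i : ℕ) : ℝ) + 1)) *
          (D i + D (i + 2) - 2 * D (i + 1)) := by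
    intro i
    have hw := weight_nonneg (n := n) (j := i + 1) (by omega)
    have hl := (h.local_bounds i).2.2
    have hl' : ((y.ht (i + 1) : ℝ) + (swapAt i y).ht (i + 1)) -
        (x.ht (i + 1) + (swapAt i x).ht (i + 1)) ≤
        (y.ht i + y.ht (i + 2)) - (x.ht i + x.ht (i + 2)) := by exact_mod_cast hl
    rw [area_swapAt, area_swapAt]
    push_cast at hw ⊢
    have := mul_le_mul_of_nonneg_left hl' hw
    simp only [hD]
    linarith
  have hN : ((3 * n - 1 : ℕ) : ℝ) = 3 * n - 1 := by
    rw [Nat.cast_sub (by omega)]; push_cast; ring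
  have hN1 : 3 * n - 1 + 1 = 3 * n := by omega
  -- With `M = 3n - 1` all boundary terms vanish: two because `D` is zero at both ends, the third
  -- because the weight is zero at `3n`.
  have hsum := sum_weight_mul_laplacian (3 * n) D (3 * n - 1)
  rw [hN1, hDN, hD0, hN] at hsum
  have hDsum : y.area - x.area ≤
      (3 * n : ℝ) ^ 2 * ∑ i ∈ Finset.range (3 * n - 1), D (i + 1) := by
    have e : ∑ i ∈ Finset.range (3 * n - 1), D (i + 1) =
        ∑ j ∈ Finset.range (3 * n + 1), D j := by
      rw [Finset.sum_range_succ, hDN, add_zero]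
      conv_rhs => rw [← hN1, Finset.sum_range_succ', hD0, add_zero]
    rw [e, area_sub_area, Finset.mul_sum]
    refine Finset.sum_le_sum fun j hj => ?_
    have hj' : j ≤ 3 * n := by have := Finset.mem_range.1 hj; omega
    have := h j hj'
    exact mul_le_mul_of_nonneg_right (weight_le hj') (sub_nonneg.2 (by exact_mod_cast this))
  calc _ ≤ ∑ i : Fin (3 * n - 1), (((i : ℕ) : ℝ) + 1) * (3 * n - (((i : ℕ) : ℝ) + 1)) *
          (D i + D (i + 2) - 2 * D (i + 1)) := Finset.sum_le_sum fun i _ => hterm i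
    _ = -2 * ∑ i ∈ Finset.range (3 * n - 1), D (i + 1) := by
        rw [Fin.sum_univ_eq_sum_range (fun i : ℕ => ((i : ℝ) + 1) * (3 * n - ((i : ℝ) + 1)) *
          (D i + D (i + 2) - 2 * D (i + 1))), hsum]
        ring
    _ ≤ _ := by
        have := (div_le_iff₀' hpos).2 hDsum
        have e : -(2 / (3 * n : ℝ) ^ 2) * (y.area - x.area) =
          -2 * ((y.area - x.area) / (3 * n : ℝ) ^ 2) := by ring
        rw [e]
        linarith

end Path

/-! ### Contraction of Lipschitz constants. -/

open TwoDyck.Path Matrix in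
/-- One step of the chain averages over the two updates at a uniform position. -/
theorem amChain_mulVec (n : ℕ) (f : Path n → ℝ) (x : Path n) :
    (amChain n *ᵥ f) x =
      1 / (3 * (n : ℝ) - 1) * ∑ i : Fin (3 * n - 1), (f x + f (swapAt i x)) / 2 := by
  have h : ∀ i : Fin (3 * n - 1),
      ∑ y, moveProb i x y * f y = (f x + f (swapAt i x)) / 2 := by
    intro i
    unfold moveProb swapAt
    by_cases hp : IsPath n (adjSwap x.1 i)
    · have : ∀ y : Path n, (y.1 = adjSwap x.1 i) = (y = ⟨adjSwap x.1 i, hp⟩) := by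
        intro y; rw [Subtype.ext_iff]
      simp only [hp, if_true, dite_true, this, add_mul, ite_mul, zero_mul,
        Finset.sum_add_distrib, Finset.sum_ite_eq', Finset.mem_univ]
      ring
    · simp [hp]
  simp only [mulVec, dotProduct, amChain, Finset.sum_mul]
  rw [Finset.sum_comm, Finset.mul_sum]
  refine Finset.sum_congr rfl fun i _ => ?_
  rw [← h i, Finset.mul_sum]
  exact Finset.sum_congr rfl fun y _ => by ring

open TwoDyck.Path Matrix in
theorem abs_amChain_mulVec_sub_le {n : ℕ} (hn : 1 ≤ n) {f : Path n → ℝ} {L : ℝ} (hL : 0 ≤ L)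
    (hf : ∀ x y, Below x y → |f y - f x| ≤ L * (y.area - x.area)) {x y : Path n}
    (h : Below x y) :
    |(amChain n *ᵥ f) y - (amChain n *ᵥ f) x| ≤
      (1 - 1 / (3 * n : ℝ) ^ 3) * L * (y.area - x.area) := by
  have h1 : (1 : ℝ) ≤ n := by exact_mod_cast hn
  have hpos : (0 : ℝ) < 3 * n - 1 := by linarith
  have hN : ((3 * n - 1 : ℕ) : ℝ) = 3 * n - 1 := by
    rw [Nat.cast_sub (by omega)]; push_cast; ring
  have hA : 0 ≤ y.area - x.area := sub_nonneg.2 h.area_le_area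
  rw [amChain_mulVec, amChain_mulVec, ← mul_sub, ← Finset.sum_sub_distrib, abs_mul,
    abs_of_pos (by positivity : 0 < 1 / (3 * (n : ℝ) - 1))]
  have hterm : ∀ i : Fin (3 * n - 1),
      |(f y + f (swapAt i y)) / 2 - (f x + f (swapAt i x)) / 2| ≤
        L * (y.area - x.area) +
          L / 2 * ((swapAt i y).area - (swapAt i x).area - (y.area - x.area)) := by
    intro i
    -- Regrouping the outcomes couples raise with raise and lower with lower, so the Lipschitz
    -- hypothesis is applied only to ordered pairs.
    rw [← raise_add_lower, ← raise_add_lower]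
    have a1 := abs_le.1 (hf _ _ (h.raise i))
    have a2 := abs_le.1 (hf _ _ (h.lower i))
    have a3 := raise_add_lower i x area
    have a4 := raise_add_lower i y area
    have e : L * (y.area - x.area) +
          L / 2 * ((swapAt i y).area - (swapAt i x).area - (y.area - x.area)) =
        (L * ((raise i y).area - (raise i x).area) +
          L * ((lower i y).area - (lower i x).area)) / 2 := by
      linear_combination (L / 2) * (a3 - a4)
    rw [e, abs_le]
    constructor <;> linarith
  have hsum := (Finset.abs_sum_le_sum_abs _ _).trans
    (Finset.sum_le_sum fun i (_ : i ∈ Finset.univ) => hterm i)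
  rw [Finset.sum_add_distrib, ← Finset.mul_sum (a := L / 2), Finset.sum_const, Finset.card_univ,
    Fintype.card_fin, nsmul_eq_mul, hN] at hsum
  have hdrift := mul_le_mul_of_nonneg_left (h.sum_area_swapAt_le hn) (by positivity : 0 ≤ L / 2)
  calc _ ≤ 1 / (3 * (n : ℝ) - 1) * ((3 * n - 1) * (L * (y.area - x.area)) +
          L / 2 * (-(2 / (3 * n : ℝ) ^ 2) * (y.area - x.area))) := by
        refine mul_le_mul_of_nonneg_left (hsum.trans ?_) (by positivity)
        linarith
    _ = (1 - 1 / ((3 * n - 1) * (3 * n : ℝ) ^ 2)) * (L * (y.area - x.area)) := by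
        field_simp
        ring
    _ ≤ (1 - 1 / (3 * n : ℝ) ^ 3) * (L * (y.area - x.area)) := by
        refine mul_le_mul_of_nonneg_right ?_ (mul_nonneg hL hA)
        have : (3 * (n : ℝ) - 1) * (3 * n : ℝ) ^ 2 ≤ (3 * n : ℝ) ^ 3 := by
          nlinarith [sq_nonneg (3 * (n : ℝ))]
        have := one_div_le_one_div_of_le (by positivity) this
        linarith
    _ = _ := by ring

open TwoDyck.Path Matrix in
theorem abs_amChain_pow_mulVec_sub_le_of_below {n : ℕ} (hn : 1 ≤ n) {f : Path n → ℝ} {L : ℝ}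
    (hL : 0 ≤ L) (hf : ∀ x y, |f y - f x| ≤ L) (t : ℕ) {x y : Path n} (h : Below x y) :
    |((amChain n ^ t) *ᵥ f) y - ((amChain n ^ t) *ᵥ f) x| ≤
      (1 - 1 / (3 * n : ℝ) ^ 3) ^ t * L * (y.area - x.area) := by
  have hδ : 0 ≤ 1 - 1 / (3 * n : ℝ) ^ 3 := by
    have h1 : (1 : ℝ) ≤ n := by exact_mod_cast hn
    have : (1 : ℝ) ≤ (3 * n : ℝ) ^ 3 := one_le_pow₀ (by linarith)
    have := div_le_one_of_le₀ this (by positivity)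
    linarith
  induction t generalizing x y with
  | zero =>
    simp only [pow_zero, one_mulVec, one_mul]
    by_cases hxy : x = y
    · simp [hxy]
    · exact (hf x y).trans (le_mul_of_one_le_right hL (h.one_le_area_sub hxy))
  | succ t ih =>
    rw [pow_succ', ← mulVec_mulVec, pow_succ', mul_assoc]
    have := abs_amChain_mulVec_sub_le hn (mul_nonneg (pow_nonneg hδ t) hL)
      (fun x y hxy => ih hxy) h
    linarith

open TwoDyck.Path Matrix in
theorem abs_amChain_pow_mulVec_sub_le {n : ℕ} (hn : 1 ≤ n) {f : Path n → ℝ} {L : ℝ}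
    (hL : 0 ≤ L) (hf : ∀ x y, |f y - f x| ≤ L) (t : ℕ) (x y : Path n) :
    |((amChain n ^ t) *ᵥ f) y - ((amChain n ^ t) *ᵥ f) x| ≤
      4 * (3 * n : ℝ) ^ 4 * L * (1 - 1 / (3 * n : ℝ) ^ 3) ^ t := by
  have hδ : 0 ≤ 1 - 1 / (3 * n : ℝ) ^ 3 := by
    have h1 : (1 : ℝ) ≤ n := by exact_mod_cast hn
    have : (1 : ℝ) ≤ (3 * n : ℝ) ^ 3 := one_le_pow₀ (by linarith)
    have := div_le_one_of_le₀ this (by positivity)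
    linarith
  have key : ∀ z : Path n, |((amChain n ^ t) *ᵥ f) (top n) - ((amChain n ^ t) *ᵥ f) z| ≤
      (1 - 1 / (3 * n : ℝ) ^ 3) ^ t * L * (2 * (3 * n : ℝ) ^ 4) := by
    intro z
    refine (abs_amChain_pow_mulVec_sub_le_of_below hn hL hf t z.below_top).trans ?_
    refine mul_le_mul_of_nonneg_left ?_ (mul_nonneg (pow_nonneg hδ t) hL)
    have := area_le hn (top n)
    have := z.area_nonneg
    -- Comparing both `x` and `y` with `top` doubles the area bound `2 (3n)^4`, hence the factor 4.
    linarith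
  have kx := abs_le.1 (key x)
  have ky := abs_le.1 (key y)
  rw [abs_le]
  constructor <;> linarith

end TwoDyck

/-! ### From oscillation decay to mixing time and spectral gap, for symmetric chains. -/

namespace FiniteChain

open Matrix

/-- A log-convex sequence that decays like `K ρ ^ t` decays at rate `ρ` already in its first
step. -/
theorem le_mul_of_logConvex {a : ℕ → ℝ} {K ρ : ℝ} (hρ : 0 ≤ ρ) (ha : ∀ t, 0 ≤ a t)
    (hconv : ∀ t, a (t + 1) ^ 2 ≤ a t * a (t + 2)) (hdecay : ∀ t, a t ≤ K * ρ ^ t) :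
    a 1 ≤ ρ * a 0 := by
  by_contra hcon
  push Not at hcon
  have ha0 : 0 < a 0 := by
    refine lt_of_le_of_ne (ha 0) fun h0 => ?_
    have := hconv 0
    rw [← h0, zero_mul] at this
    rw [← h0, mul_zero] at hcon
    simp only [zero_add] at this
    nlinarith
  have ha1 : 0 < a 1 := lt_of_le_of_lt (mul_nonneg hρ (ha 0)) hcon
  set r := a 1 / a 0 with hr
  have hrpos : 0 < r := div_pos ha1 ha0
  have hρr : ρ < r := by rw [hr, lt_div_iff₀ ha0]; exact hcon
  -- Log-convexity makes successive ratios nondecreasing, so a first ratio `r > ρ` would force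
  -- growth at least like `r ^ t`.
  have hstep : ∀ t, 0 < a t ∧ r * a t ≤ a (t + 1) := by
    intro t
    induction t with
    | zero => exact ⟨ha0, by rw [hr, div_mul_cancel₀ _ ha0.ne']⟩
    | succ t ih =>
      obtain ⟨h1, h2⟩ := ih
      have h3 : 0 < a (t + 1) := lt_of_lt_of_le (mul_pos hrpos h1) h2
      refine ⟨h3, ?_⟩
      have h4 := hconv t
      refine le_of_mul_le_mul_left ?_ h1
      calc a t * (r * a (t + 1)) = (r * a t) * a (t + 1) := by ring
        _ ≤ a (t + 1) * a (t + 1) := mul_le_mul_of_nonneg_right h2 h3.le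
        _ ≤ a t * a (t + 1 + 1) := by rw [← sq]; exact h4
  have hgrow : ∀ t, a 0 * r ^ t ≤ a t := by
    intro t
    induction t with
    | zero => simp
    | succ t ih =>
      calc a 0 * r ^ (t + 1) = r * (a 0 * r ^ t) := by ring
        _ ≤ r * a t := mul_le_mul_of_nonneg_left ih hrpos.le
        _ ≤ _ := (hstep t).2
  have hlim : Filter.Tendsto (fun t => K * (ρ / r) ^ t) Filter.atTop (nhds 0) := by
    have := (tendsto_pow_atTop_nhds_zero_of_lt_one (div_nonneg hρ hrpos.le)
      ((div_lt_one hrpos).2 hρr)).const_mul K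
    simpa using this
  have hge : ∀ t, a 0 ≤ K * (ρ / r) ^ t := by
    intro t
    rw [div_pow, ← mul_div_assoc, le_div_iff₀ (pow_pos hrpos t)]
    exact (hgrow t).trans (hdecay t)
  exact absurd (ge_of_tendsto' hlim hge) (not_le.2 ha0)

variable {Ω : Type*} [Fintype Ω]

theorem sum_row_eq_one {P : Matrix Ω Ω ℝ} (hone : P *ᵥ 1 = 1) (x : Ω) : ∑ y, P x y = 1 := by
  simpa [mulVec, dotProduct] using congrFun hone x

theorem sum_col_eq_one {P : Matrix Ω Ω ℝ} (hsymm : Pᵀ = P) (hone : P *ᵥ 1 = 1) (y : Ω) :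
    ∑ x, P x y = 1 := by
  rw [← sum_row_eq_one hone y]
  exact Finset.sum_congr rfl fun x _ => congrFun (congrFun hsymm y) x

theorem dotProduct_mulVec_comm {P : Matrix Ω Ω ℝ} (hsymm : Pᵀ = P) (f g : Ω → ℝ) :
    (P *ᵥ f) ⬝ᵥ g = f ⬝ᵥ (P *ᵥ g) := by
  rw [dotProduct_mulVec, ← mulVec_transpose, hsymm]

theorem dotProduct_sq_le (f g : Ω → ℝ) : (f ⬝ᵥ g) ^ 2 ≤ (f ⬝ᵥ f) * (g ⬝ᵥ g) := by
  have := Finset.sum_mul_sq_le_sq_mul_sq Finset.univ f g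
  simpa only [dotProduct, sq] using this

theorem dirichletForm_uniform {P : Matrix Ω Ω ℝ} (hsymm : Pᵀ = P) (hone : P *ᵥ 1 = 1)
    (f : Ω → ℝ) :
    dirichletForm P (uniform Ω) f f =
      1 / (Fintype.card Ω : ℝ) * (f ⬝ᵥ f - f ⬝ᵥ (P *ᵥ f)) := by
  have hrow := sum_row_eq_one hone
  have hcol := sum_col_eq_one hsymm hone
  have e1 : ∑ x, ∑ y, f x * f x * P x y = f ⬝ᵥ f := by
    simp only [← Finset.mul_sum, hrow, mul_one, dotProduct]
  have e2 : ∑ x, ∑ y, f y * f y * P x y = f ⬝ᵥ f := by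
    rw [Finset.sum_comm]
    simp only [← Finset.mul_sum, hcol, mul_one, dotProduct]
  have e3 : ∑ x, ∑ y, f x * (P x y * f y) = f ⬝ᵥ (P *ᵥ f) := by
    simp only [← Finset.mul_sum, dotProduct, mulVec]
  have : ∑ x, ∑ y, (f x - f y) * (f x - f y) * uniform Ω x * P x y =
      1 / (Fintype.card Ω : ℝ) * (∑ x, ∑ y, f x * f x * P x y + ∑ x, ∑ y, f y * f y * P x y
        - 2 * ∑ x, ∑ y, f x * (P x y * f y)) := by
    simp only [Finset.mul_sum, ← Finset.sum_add_distrib, ← Finset.sum_sub_distrib, uniform]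
    exact Finset.sum_congr rfl fun x _ => Finset.sum_congr rfl fun y _ => by ring
  rw [dirichletForm, this, e1, e2, e3]
  ring

theorem variance_uniform (f : Ω → ℝ) :
    variance (uniform Ω) f = 1 / (Fintype.card Ω : ℝ) * (f ⬝ᵥ f) -
      (1 / (Fintype.card Ω : ℝ) * ∑ x, f x) ^ 2 := by
  simp only [variance, uniform, dotProduct, Finset.mul_sum, sq]

theorem dirichletForm_sub_const (P : Matrix Ω Ω ℝ) (π f : Ω → ℝ) (c : ℝ) :
    dirichletForm P π (fun x => f x - c) (fun x => f x - c) = dirichletForm P π f f := by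
  simp [dirichletForm]

theorem variance_eq_sub_mean [Nonempty Ω] (f : Ω → ℝ) {c : ℝ}
    (hc : c = 1 / (Fintype.card Ω : ℝ) * ∑ x, f x) :
    variance (uniform Ω) f =
      1 / (Fintype.card Ω : ℝ) * ((fun x => f x - c) ⬝ᵥ fun x => f x - c) := by
  have hcard : (Fintype.card Ω : ℝ) ≠ 0 := by exact_mod_cast Fintype.card_ne_zero
  have hs : ∑ x, f x = Fintype.card Ω * c := by rw [hc]; field_simp
  have : ((fun x => f x - c) ⬝ᵥ fun x => f x - c) =
      f ⬝ᵥ f - 2 * c * ∑ x, f x + Fintype.card Ω * c ^ 2 := by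
    simp only [dotProduct]
    rw [Finset.mul_sum, ← Finset.sum_sub_distrib]
    have : (Fintype.card Ω : ℝ) * c ^ 2 = ∑ _x : Ω, c ^ 2 := by simp
    rw [this, ← Finset.sum_add_distrib]
    exact Finset.sum_congr rfl fun x _ => by ring
  rw [variance_uniform, this, ← hc, hs]
  field_simp
  ring

variable [DecidableEq Ω]

/-- If all bounded functions are flattened by `P ^ t`, the chain is close to uniform at time
`t`. -/
theorem worstDist_le_of_osc [Nonempty Ω] {P : Matrix Ω Ω ℝ} (hsymm : Pᵀ = P)
    (hone : P *ᵥ 1 = 1) (t : ℕ) {ε : ℝ}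
    (h : ∀ f : Ω → ℝ, (∀ x y, |f y - f x| ≤ 2) →
      ∀ x y, |((P ^ t) *ᵥ f) y - ((P ^ t) *ᵥ f) x| ≤ 2 * ε) :
    worstDist P (uniform Ω) t ≤ ε := by
  refine ciSup_le fun x => ?_
  have hcard : (0 : ℝ) < Fintype.card Ω := by exact_mod_cast Fintype.card_pos
  have hpow : ∀ k : ℕ, (P ^ k) *ᵥ (1 : Ω → ℝ) = 1 := fun k => by
    induction k with
    | zero => simp
    | succ k ih => rw [pow_succ, ← mulVec_mulVec, hone, ih]
  have hcol := sum_col_eq_one (by rw [transpose_pow, hsymm]) (hpow t)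
  -- The sign function realises the `ℓ¹` distance. Invariance of the uniform law then writes that
  -- distance as an average of differences of `P ^ t s`.
  set s : Ω → ℝ := fun y => if 0 ≤ (P ^ t) x y - uniform Ω y then 1 else -1 with hs
  have hosc : ∀ a b, |s b - s a| ≤ 2 := by
    intro a b
    simp only [hs]
    split_ifs <;> norm_num
  have habs : ∀ y, |(P ^ t) x y - uniform Ω y| = (P ^ t) x y * s y - uniform Ω y * s y := by
    intro y
    simp only [hs]
    split_ifs with h0
    · rw [abs_of_nonneg h0]; ring
    · rw [abs_of_neg (not_le.1 h0)]; ring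
  have hmean : ∑ y, uniform Ω y * s y =
      1 / (Fintype.card Ω : ℝ) * ∑ z, ((P ^ t) *ᵥ s) z := by
    simp only [mulVec, dotProduct, uniform]
    rw [Finset.sum_comm, Finset.mul_sum]
    refine Finset.sum_congr rfl fun y _ => ?_
    rw [← Finset.sum_mul, hcol, one_mul]
  have hdiff : ∑ y, |(P ^ t) x y - uniform Ω y| =
      1 / (Fintype.card Ω : ℝ) * ∑ z, (((P ^ t) *ᵥ s) x - ((P ^ t) *ᵥ s) z) := by
    rw [Finset.sum_congr rfl fun y _ => habs y, Finset.sum_sub_distrib, hmean,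
      Finset.sum_sub_distrib, Finset.sum_const, Finset.card_univ, nsmul_eq_mul, mul_sub,
      ← mul_assoc, one_div_mul_cancel hcard.ne', one_mul]
    rfl
  have hle : ∑ z, (((P ^ t) *ᵥ s) x - ((P ^ t) *ᵥ s) z) ≤ Fintype.card Ω * (2 * ε) := by
    refine (Finset.sum_le_card_nsmul _ _ (2 * ε) fun z _ =>
      (le_abs_self _).trans (h s hosc z x)).trans_eq ?_
    rw [Finset.card_univ, nsmul_eq_mul]
  have := mul_le_mul_of_nonneg_left hle (one_div_pos.2 hcard).le
  rw [← mul_assoc, one_div_mul_cancel hcard.ne'] at this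
  rw [tvDist, hdiff]
  linarith

theorem mixingTime_le {P : Matrix Ω Ω ℝ} {π : Ω → ℝ} {t : ℕ} (h : worstDist P π t ≤ 1 / 4) :
    mixingTime P π ≤ t :=
  Nat.sInf_le h

/-- Uniform decay of `P ^ t f` at rate `ρ` bounds the Rayleigh quotient of `f`. -/
theorem dotProduct_mulVec_le_of_decay {P : Matrix Ω Ω ℝ} (hsymm : Pᵀ = P) {ρ : ℝ} (hρ : 0 ≤ ρ)
    {f : Ω → ℝ} {K : ℝ} (hdecay : ∀ t x, |((P ^ t) *ᵥ f) x| ≤ K * ρ ^ t) :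
    f ⬝ᵥ (P *ᵥ f) ≤ ρ * (f ⬝ᵥ f) := by
  set u : ℕ → Ω → ℝ := fun t => (P ^ t) *ᵥ f with hu
  have hsucc : ∀ t, u (t + 1) = P *ᵥ u t := by
    intro t; simp only [hu]; rw [mulVec_mulVec, ← pow_succ']
  have h0 : u 0 = f := by simp [hu]
  have hnn : ∀ t, 0 ≤ u t ⬝ᵥ u t := fun t => Finset.sum_nonneg fun x _ => mul_self_nonneg _
  have hconv : ∀ t, (u (t + 1) ⬝ᵥ u (t + 1)) ^ 2 ≤ (u t ⬝ᵥ u t) * (u (t + 2) ⬝ᵥ u (t + 2)) := by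
    intro t
    have : u (t + 1) ⬝ᵥ u (t + 1) = u t ⬝ᵥ u (t + 2) := by
      -- Symmetry moves one factor of `P` across the product; Cauchy–Schwarz then gives
      -- log-convexity.
      conv_lhs => rw [hsucc t, dotProduct_mulVec_comm hsymm, ← hsucc t, ← hsucc (t + 1)]
    rw [this]
    exact dotProduct_sq_le _ _
  have hdec : ∀ t, u t ⬝ᵥ u t ≤ (Fintype.card Ω * K ^ 2) * (ρ ^ 2) ^ t := by
    intro t
    have : ∀ x ∈ Finset.univ, u t x * u t x ≤ K ^ 2 * (ρ ^ 2) ^ t := by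
      intro x _
      have h1 := hdecay t x
      have h2 := mul_self_le_mul_self (abs_nonneg _) h1
      rw [abs_mul_abs_self] at h2
      refine h2.trans_eq ?_
      rw [← pow_mul, mul_comm 2 t, pow_mul]
      ring
    refine (Finset.sum_le_card_nsmul _ _ _ this).trans_eq ?_
    rw [Finset.card_univ, nsmul_eq_mul, mul_assoc]
  have key := le_mul_of_logConvex (sq_nonneg ρ) hnn hconv hdec
  rw [h0, hsucc 0, h0] at key
  have hff : 0 ≤ f ⬝ᵥ f := by rw [← h0]; exact hnn 0
  refine abs_le_of_sq_le_sq' ?_ (mul_nonneg hρ hff) |>.2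
  calc (f ⬝ᵥ (P *ᵥ f)) ^ 2 ≤ (f ⬝ᵥ f) * ((P *ᵥ f) ⬝ᵥ (P *ᵥ f)) := dotProduct_sq_le _ _
    _ ≤ (f ⬝ᵥ f) * (ρ ^ 2 * (f ⬝ᵥ f)) := mul_le_mul_of_nonneg_left key hff
    _ = _ := by ring

theorem spectralGap_ge_of_osc [Nontrivial Ω] {P : Matrix Ω Ω ℝ} (hsymm : Pᵀ = P)
    (hone : P *ᵥ 1 = 1) {ρ : ℝ} (hρ : 0 ≤ ρ) {B : ℝ}
    (h : ∀ (f : Ω → ℝ) (L : ℝ), 0 ≤ L → (∀ x y, |f y - f x| ≤ L) →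
      ∀ t x y, |((P ^ t) *ᵥ f) y - ((P ^ t) *ᵥ f) x| ≤ B * L * ρ ^ t) :
    1 - ρ ≤ spectralGap P (uniform Ω) := by
  have hcard : (0 : ℝ) < Fintype.card Ω := by exact_mod_cast Fintype.card_pos
  apply le_csInf
  -- The indicator of a point has variance `p - p ^ 2` with `p = 1 / |Ω| < 1`.
  · obtain ⟨a, b, hab⟩ := exists_pair_ne Ω
    refine ⟨_, Pi.single a 1, ?_, rfl⟩
    have hc1 : (1 : ℝ) < Fintype.card Ω := by exact_mod_cast Fintype.one_lt_card
    rw [variance_uniform]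
    simp only [dotProduct_single_one, Pi.single_eq_same, Finset.sum_pi_single', Finset.mem_univ,
      if_true]
    apply ne_of_gt
    have : 1 / (Fintype.card Ω : ℝ) < 1 := (div_lt_one hcard).2 hc1
    have : 0 < 1 / (Fintype.card Ω : ℝ) := by positivity
    nlinarith
  rintro r ⟨f, hvar, rfl⟩
  set c := 1 / (Fintype.card Ω : ℝ) * ∑ x, f x with hc
  set g : Ω → ℝ := fun x => f x - c with hg
  have hV := variance_eq_sub_mean f hc
  have hgg : 0 ≤ g ⬝ᵥ g := Finset.sum_nonneg fun x _ => mul_self_nonneg _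
  have hVpos : 0 < variance (uniform Ω) f :=
    lt_of_le_of_ne (by rw [hV]; exact mul_nonneg (by positivity) hgg) hvar.symm
  have hgsum : ∑ x, g x = 0 := by
    simp only [hg, Finset.sum_sub_distrib, Finset.sum_const, Finset.card_univ, nsmul_eq_mul, hc]
    field_simp
    ring
  have hpowsum : ∀ t, ∑ x, ((P ^ t) *ᵥ g) x = 0 := by
    intro t
    have hstep : ∀ k : Ω → ℝ, ∑ x, (P *ᵥ k) x = ∑ x, k x := by
      intro k
      have := dotProduct_mulVec_comm hsymm k 1
      rw [hone] at this
      simpa only [dotProduct_one] using this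
    induction t with
    | zero => simpa using hgsum
    | succ t ih => rw [pow_succ', ← mulVec_mulVec, hstep, ih]
  obtain ⟨L, hL0, hL⟩ : ∃ L : ℝ, 0 ≤ L ∧ ∀ x y, |g y - g x| ≤ L := by
    -- A crude bound suffices: only the rate `ρ` survives, not the prefactor.
    refine ⟨∑ x, ∑ y, |g y - g x|, by positivity, fun x y => ?_⟩
    refine (Finset.single_le_sum (f := fun y => |g y - g x|) (fun _ _ => abs_nonneg _)
      (Finset.mem_univ y)).trans ?_
    exact Finset.single_le_sum (f := fun x => ∑ y, |g y - g x|)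
      (fun _ _ => Finset.sum_nonneg fun _ _ => abs_nonneg _) (Finset.mem_univ x)
  have hdecay : ∀ t x, |((P ^ t) *ᵥ g) x| ≤ (B * L) * ρ ^ t := by
    intro t x
    have h1 : (Fintype.card Ω : ℝ) * ((P ^ t) *ᵥ g) x =
        ∑ z, (((P ^ t) *ᵥ g) x - ((P ^ t) *ᵥ g) z) := by
      rw [Finset.sum_sub_distrib, hpowsum t, Finset.sum_const, Finset.card_univ, nsmul_eq_mul,
        sub_zero]
    have h2 := (Finset.abs_sum_le_sum_abs _ _).trans (Finset.sum_le_card_nsmul Finset.univ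
      (fun z => |((P ^ t) *ᵥ g) x - ((P ^ t) *ᵥ g) z|) _ fun z _ => h g L hL0 hL t z x)
    rw [← h1, abs_mul, abs_of_pos hcard, Finset.card_univ, nsmul_eq_mul] at h2
    exact le_of_mul_le_mul_left h2 hcard
  have key := dotProduct_mulVec_le_of_decay hsymm hρ hdecay
  rw [le_div_iff₀ hVpos, hV, ← dirichletForm_sub_const P _ f c, dirichletForm_uniform hsymm hone]
  have : 0 < 1 / (Fintype.card Ω : ℝ) := by positivity
  have := mul_le_mul_of_nonneg_left key this.le
  change (1 - ρ) * (1 / (Fintype.card Ω : ℝ) * (g ⬝ᵥ g)) ≤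
    1 / (Fintype.card Ω : ℝ) * (g ⬝ᵥ g - g ⬝ᵥ (P *ᵥ g))
  linarith

end FiniteChain

/-! ### Application to the adjacent move chain and explicit constants. -/

namespace TwoDyck

open Matrix

theorem amChain_transpose (n : ℕ) : (amChain n)ᵀ = amChain n := by
  ext X Y
  exact amChain_symm Y X

theorem amChain_mulVec_one {n : ℕ} (hn : 1 ≤ n) : amChain n *ᵥ 1 = 1 := by
  funext X
  simpa [mulVec, dotProduct] using amChain_row_sum hn X

theorem worstDist_amChain_le {n : ℕ} (hn : 1 ≤ n) (t : ℕ) :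
    FiniteChain.worstDist (amChain n) (FiniteChain.uniform (Path n)) t ≤
      4 * (3 * n : ℝ) ^ 4 * (1 - 1 / (3 * n : ℝ) ^ 3) ^ t := by
  have : Nonempty (Path n) := ⟨Path.top n⟩
  refine FiniteChain.worstDist_le_of_osc (amChain_transpose n) (amChain_mulVec_one hn) t
    fun f hf x y => ?_
  refine (abs_amChain_pow_mulVec_sub_le hn zero_le_two hf t x y).trans_eq ?_
  ring

theorem worstDist_amChain_le_quarter {n t : ℕ} (hn : 1 ≤ n)
    (ht : (3 * n : ℝ) ^ 3 * Real.log (16 * (3 * n : ℝ) ^ 4) ≤ t) :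
    FiniteChain.worstDist (amChain n) (FiniteChain.uniform (Path n)) t ≤ 1 / 4 := by
  have h1 : (1 : ℝ) ≤ n := by exact_mod_cast hn
  have hδ : 0 ≤ 1 - 1 / (3 * n : ℝ) ^ 3 := by
    have : (1 : ℝ) ≤ (3 * n : ℝ) ^ 3 := one_le_pow₀ (by linarith)
    have := div_le_one_of_le₀ this (by positivity)
    linarith
  have hexp : (1 - 1 / (3 * n : ℝ) ^ 3) ^ t ≤ 1 / (16 * (3 * n : ℝ) ^ 4) := by
    calc (1 - 1 / (3 * n : ℝ) ^ 3) ^ t ≤ Real.exp (-(1 / (3 * n : ℝ) ^ 3)) ^ t :=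
          pow_le_pow_left₀ hδ (Real.one_sub_le_exp_neg _) t
      _ = Real.exp (-(t / (3 * n : ℝ) ^ 3)) := by
          rw [← Real.exp_nat_mul]; congr 1; ring
      _ ≤ Real.exp (-Real.log (16 * (3 * n : ℝ) ^ 4)) := by
          rw [Real.exp_le_exp, neg_le_neg_iff, le_div_iff₀' (by positivity)]
          exact ht
      _ = _ := by rw [Real.exp_neg, Real.exp_log (by positivity), one_div]
  refine (worstDist_amChain_le hn t).trans ?_
  calc _ ≤ 4 * (3 * n : ℝ) ^ 4 * (1 / (16 * (3 * n : ℝ) ^ 4)) :=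
        mul_le_mul_of_nonneg_left hexp (by positivity)
    _ = 1 / 4 := by field_simp; norm_num

theorem log_two_le_log {n : ℕ} (hn : 2 ≤ n) : Real.log 2 ≤ Real.log n :=
  Real.log_le_log (by norm_num) (by exact_mod_cast hn)

theorem log_sixteen_mul_le {n : ℕ} (hn : 2 ≤ n) :
    Real.log (16 * (3 * n : ℝ) ^ 4) ≤ 16 * Real.log n := by
  have h2 : (2 : ℝ) ≤ n := by exact_mod_cast hn
  have h0 : (0 : ℝ) < n := by linarith
  have hle : 16 * (3 * n : ℝ) ^ 4 ≤ (n : ℝ) ^ 16 := by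
    -- `16 · 3 ^ 4 = 1296 ≤ 2 ^ 12`.
    have h12 : (2 : ℝ) ^ 12 ≤ (n : ℝ) ^ 12 := pow_le_pow_left₀ (by norm_num) h2 12
    calc 16 * (3 * n : ℝ) ^ 4 = 1296 * (n : ℝ) ^ 4 := by ring
      _ ≤ (n : ℝ) ^ 12 * (n : ℝ) ^ 4 :=
        mul_le_mul_of_nonneg_right (by linarith) (by positivity)
      _ = _ := by ring
  calc _ ≤ Real.log ((n : ℝ) ^ 16) := Real.log_le_log (by positivity) hle
    _ = _ := by rw [Real.log_pow]; norm_num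

theorem spectralGap_amChain_ge {n : ℕ} (hn : 2 ≤ n) :
    1 / (3 * n : ℝ) ^ 3 ≤
      FiniteChain.spectralGap (amChain n) (FiniteChain.uniform (Path n)) := by
  have h1 : (1 : ℝ) ≤ n := by exact_mod_cast (by omega : 1 ≤ n)
  have hδ : 0 ≤ 1 - 1 / (3 * n : ℝ) ^ 3 := by
    have : (1 : ℝ) ≤ (3 * n : ℝ) ^ 3 := one_le_pow₀ (by linarith)
    have := div_le_one_of_le₀ this (by positivity)
    linarith
  obtain ⟨x, hx⟩ := Path.exists_ne_top hn
  have : Nontrivial (Path n) := ⟨x, _, hx⟩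
  have := FiniteChain.spectralGap_ge_of_osc (amChain_transpose n)
    (amChain_mulVec_one (by omega)) hδ
    (fun f L hL hf t x y => abs_amChain_pow_mulVec_sub_le (by omega) hL hf t x y)
  linarith

end TwoDyck

theorem mainTheorem2 :
    (∃ C : ℝ, ∀ n : ℕ, 2 ≤ n →
      (∃ t, FiniteChain.worstDist (TwoDyck.amChain n)
        (FiniteChain.uniform (TwoDyck.Path n)) t ≤ 1 / 4) ∧
      (FiniteChain.mixingTime (TwoDyck.amChain n)
        (FiniteChain.uniform (TwoDyck.Path n)) : ℝ) ≤ C * ((n : ℝ) ^ 3 * Real.log n)) ∧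
    (∃ C : ℝ, ∀ n : ℕ, 2 ≤ n →
      0 < FiniteChain.spectralGap (TwoDyck.amChain n)
        (FiniteChain.uniform (TwoDyck.Path n)) ∧
      1 / FiniteChain.spectralGap (TwoDyck.amChain n)
        (FiniteChain.uniform (TwoDyck.Path n)) ≤ C * ((n : ℝ) ^ 3 * Real.log n)) := by
  have hbasic : ∀ n : ℕ, 2 ≤ n → (2 : ℝ) ≤ n ∧ 1 / 2 ≤ Real.log n := fun n hn =>
    ⟨by exact_mod_cast hn, by
      have := TwoDyck.log_two_le_log hn
      have := Real.log_two_gt_d9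
      linarith⟩
  constructor
  -- `27 · 16` comes from `(3n)^3` and the bound `16 log n`; the extra 1 pays for the ceiling, as `n
  -- ^ 3 log n ≥ 1`.
  · refine ⟨27 * 16 + 1, fun n hn => ?_⟩
    obtain ⟨h2, hlog⟩ := hbasic n hn
    set T : ℝ := (3 * n : ℝ) ^ 3 * Real.log (16 * (3 * n : ℝ) ^ 4) with hT
    have hmix := TwoDyck.worstDist_amChain_le_quarter (t := ⌈T⌉₊) (by omega) (Nat.le_ceil T)
    -- Exhibiting such a time shows that `mixingTime` is a true minimum, not the value 0 of `sInf
    -- ∅`.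
    refine ⟨⟨_, hmix⟩, ?_⟩
    have hT0 : 0 ≤ T := by
      refine mul_nonneg (by positivity) (Real.log_nonneg ?_)
      have : (1 : ℝ) ≤ (3 * n : ℝ) ^ 4 := one_le_pow₀ (by linarith)
      linarith
    have hTle : T ≤ (3 * n : ℝ) ^ 3 * (16 * Real.log n) :=
      mul_le_mul_of_nonneg_left (TwoDyck.log_sixteen_mul_le hn) (by positivity)
    have hn3 : (8 : ℝ) ≤ (n : ℝ) ^ 3 := by
      have := pow_le_pow_left₀ (by norm_num) h2 3
      linarith
    have hone : 1 ≤ (n : ℝ) ^ 3 * Real.log n := by nlinarith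
    have hle : (FiniteChain.mixingTime (TwoDyck.amChain n)
        (FiniteChain.uniform (TwoDyck.Path n)) : ℝ) ≤ (⌈T⌉₊ : ℝ) := by
      exact_mod_cast FiniteChain.mixingTime_le hmix
    have := Nat.ceil_lt_add_one hT0
    linarith
  -- The gap bound gives `27 n ^ 3` with no logarithm; `log n ≥ 1/2` brings it to the stated form.
  · refine ⟨54, fun n hn => ?_⟩
    obtain ⟨h2, hlog⟩ := hbasic n hn
    have hgap := TwoDyck.spectralGap_amChain_ge hn
    have hpos : 0 < 1 / (3 * n : ℝ) ^ 3 := by positivity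
    refine ⟨hpos.trans_le hgap, ?_⟩
    refine (one_div_le_one_div_of_le hpos hgap).trans ?_
    rw [one_div_one_div]
    have hn3 : (0 : ℝ) ≤ (n : ℝ) ^ 3 := by positivity
    nlinarith [mul_le_mul_of_nonneg_left hlog hn3]
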